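/- Let $S^1=\mathbb{R}/\mathbb{Z}$, let $J=\begin{pmatrix}0&-1\\1&0\end{pmatrix}$, and let $F\colon S^1\times\mathbb{R}^2\to\mathbb{R}^2$, $(t,x)\mapsto F(t,x)$, be a $C^\infty$ time-dependent vector field. Consider the nonlinear Cauchy--Riemann equations $$u_s-J\bigl(u_t-F(t,u)\bigr)=0,\qquad (s,t)\in\mathbb{R}\times S^1,\tag{CR}$$ for $u\in C^1(\mathbb{R}\times S^1;\mathbb{R}^2)$. For a constant $C>0$ let $X$ be the set of all $u\in C^1(\mathbb{R}\times S^1;\mathbb{R}^2)$ that satisfy (CR) and $|u(s,t)|\le C$ for all $(s,t)\in\mathbb{R}\times S^1$, endowed with the compact-open topology (uniform convergence on compact sets) inherited from $C^0(\mathbb{R}\times S^1;\mathbb{R}^2)$. Let $\iota\colon C^0(\mathbb{R}\times S^1;\mathbb{R}^2)\to C^0(S^1;\mathbb{R}^2)$, $\iota(u)=u(0,\cdot)$, where $C^0(S^1;\mathbb{R}^2)$ carries the compact-open (that is, uniform) topology. Then for every $C>0$ the mapping $\iota\colon X\to\iota(X)$ is a homeomorphism onto its image $\iota(X)$ with the subspace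 topology. In particular, a bounded solution is determined by its values on the circle $s=0$: if $u,v\in C^1(\mathbb{R}\times S^1;\mathbb{R}^2)$ are bounded solutions of (CR) with $u(0,t)=v(0,t)$ for all $t\in S^1$, then $u=v$. -/

import Mathlib

open scoped ContDiff

noncomputable section

namespace NonlinearCR

/-- The Euclidean plane `ℝ²`. -/
abbrev Plane : Type := EuclideanSpace ℝ (Fin 2)

/-- The infinite cylinder `ℝ × S¹`, where `S¹ = ℝ / ℤ`, with coordinates `(s, t)`. -/
abbrev Cylinder : Type := ℝ × UnitAddCircle

/-- The symplectic matrix `J`, acting on the plane by `J (p, q) = (-q, p)`. -/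
def J : Plane →ₗ[ℝ] Plane := Matrix.toEuclideanLin !![0, -1; 1, 0]

/-- The time-dependent vector field `F : S¹ × ℝ² → ℝ²` is smooth (of class `C^∞`). As `ℝ → ℝ / ℤ` is
a local diffeomorphism, this means that the lift of `F` to `ℝ × ℝ²`, which is `1`-periodic in `t`,
is smooth. -/
def SmoothField (F : UnitAddCircle → Plane → Plane) : Prop :=
  ContDiff ℝ ∞ fun z : ℝ × Plane => F (z.1 : UnitAddCircle) z.2

/-- `u` is a solution, of class `C¹` on the cylinder, of the nonlinear Cauchy–Riemann equations
`u_s - J (u_t - F (t, u)) = 0`. Regularity and derivatives are those of the lift of `u` to `ℝ × ℝ`,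
which is `1`-periodic in `t`. -/
structure IsSolution (F : UnitAddCircle → Plane → Plane) (u : C(Cylinder, Plane)) : Prop where
  contDiff : ContDiff ℝ 1 fun z : ℝ × ℝ => u (z.1, (z.2 : UnitAddCircle))
  equation : ∀ s t : ℝ,
    deriv (fun σ : ℝ => u (σ, (t : UnitAddCircle))) s
      - J (deriv (fun τ : ℝ => u (s, (τ : UnitAddCircle))) t
          - F (t : UnitAddCircle) (u (s, (t : UnitAddCircle)))) = 0

/-- The space `X` of the solutions `u` with `|u (s, t)| ≤ C` on the whole cylinder. As a subset of
`C⁰(ℝ × S¹; ℝ²)` it carries the compact-open topology. -/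
def solutionSpace (F : UnitAddCircle → Plane → Plane) (C : ℝ) : Set C(Cylinder, Plane) :=
  {u | IsSolution F u ∧ ∀ z : Cylinder, ‖u z‖ ≤ C}

/-- The evaluation mapping `ι : C⁰(ℝ × S¹; ℝ²) → C⁰(S¹; ℝ²)`, `u ↦ u (0, ·)`. -/
def iota (u : C(Cylinder, Plane)) : C(UnitAddCircle, Plane) :=
  u.comp ⟨fun t : UnitAddCircle => ((0 : ℝ), t), by fun_prop⟩

end NonlinearCR

end

noncomputable section

open Set Filter Topology MeasureTheory
open scoped ContDiff

namespace NonlinearCR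

/-- Differentiation under the integral sign over a compact interval. -/
theorem hasDerivAt_intervalIntegral_of_continuous {E : Type*} [NormedAddCommGroup E]
    [NormedSpace ℝ E] {f f' : ℝ → ℝ → E} (hf : Continuous (Function.uncurry f))
    (hf' : Continuous (Function.uncurry f')) (h : ∀ s t, HasDerivAt (fun σ => f σ t) (f' s t) s)
    (a b s : ℝ) : HasDerivAt (fun σ => ∫ t in a..b, f σ t) (∫ t in a..b, f' s t) s := by
  obtain ⟨K, hK⟩ := (isCompact_Icc (a := s - 1) (b := s + 1)).prod (isCompact_uIcc (a := a) (b := b))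
    |>.exists_bound_of_continuousOn hf'.continuousOn
  have hc : ∀ σ, Continuous (f σ) := fun σ => hf.comp (Continuous.prodMk_right σ)
  have hc' : ∀ σ, Continuous (f' σ) := fun σ => hf'.comp (Continuous.prodMk_right σ)
  refine (intervalIntegral.hasDerivAt_integral_of_dominated_loc_of_deriv_le
    (F := f) (F' := f') (bound := fun _ => K) (s := Icc (s - 1) (s + 1))
    (Icc_mem_nhds (by linarith) (by linarith))
    (Eventually.of_forall fun σ => (hc σ).aestronglyMeasurable)
    ((hc s).intervalIntegrable _ _) (hc' s).aestronglyMeasurable ?_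
    intervalIntegrable_const ?_).2
  · exact Eventually.of_forall fun t ht σ hσ => hK (σ, t) ⟨hσ, uIoc_subset_uIcc ht⟩
  · exact Eventually.of_forall fun t _ σ _ => h σ t

/-- The Cauchy–Schwarz inequality for continuous functions on the unit interval. -/
theorem sq_integral_inner_le {E : Type*} [NormedAddCommGroup E] [InnerProductSpace ℝ E]
    {x y : ℝ → E} (hx : Continuous x) (hy : Continuous y) :
    (∫ t in (0 : ℝ)..1, inner ℝ (x t) (y t)) ^ 2
      ≤ (∫ t in (0 : ℝ)..1, ‖x t‖ ^ 2) * ∫ t in (0 : ℝ)..1, ‖y t‖ ^ 2 := by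
  have key : ∀ c : ℝ, 0 ≤ (∫ t in (0 : ℝ)..1, ‖x t‖ ^ 2) * (c * c)
      + (2 * ∫ t in (0 : ℝ)..1, inner ℝ (x t) (y t)) * c + ∫ t in (0 : ℝ)..1, ‖y t‖ ^ 2 := by
    intro c
    have h0 : 0 ≤ ∫ t in (0 : ℝ)..1, ‖c • x t + y t‖ ^ 2 :=
      intervalIntegral.integral_nonneg zero_le_one fun t _ => by positivity
    have h1 : ∀ t, ‖c • x t + y t‖ ^ 2
        = c * c * ‖x t‖ ^ 2 + 2 * c * inner ℝ (x t) (y t) + ‖y t‖ ^ 2 := by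
      intro t
      rw [norm_add_sq_real, norm_smul, inner_smul_left, mul_pow, Real.norm_eq_abs, sq_abs]
      simp only [conj_trivial]
      ring
    simp_rw [h1] at h0
    rw [intervalIntegral.integral_add (Continuous.intervalIntegrable (by fun_prop) _ _)
      (Continuous.intervalIntegrable (by fun_prop) _ _),
      intervalIntegral.integral_add (Continuous.intervalIntegrable (by fun_prop) _ _)
      (Continuous.intervalIntegrable (by fun_prop) _ _),
      intervalIntegral.integral_const_mul, intervalIntegral.integral_const_mul] at h0
    linarith
  have := discrim_le_zero key
  rw [discrim] at this
  nlinarith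

/-- Almost convexity of `log h` when the frequency `Q / h` is almost monotone, in a form that makes
sense also where `h` vanishes. -/
theorem sq_le_exp_mul_of_frequency {h Q p Y G : ℝ → ℝ} {L : ℝ} (hL : 0 ≤ L) (h0 : ∀ s, 0 ≤ h s)
    (hh : ∀ s, HasDerivAt h (2 * Q s + 2 * p s) s)
    (hQ : ∀ s, HasDerivAt Q (2 * Y s - G s / 2) s) (hY : ∀ s, 0 ≤ Y s)
    (hp : ∀ s, |p s| ≤ L * h s) (hG : ∀ s, G s ≤ L ^ 2 * h s)
    (hCS : ∀ s, (Q s + p s / 2) ^ 2 ≤ h s * Y s) (s : ℝ) {r : ℝ} (hr : 0 ≤ r) :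
    h s ^ 2 ≤ Real.exp (2 * L ^ 2 * r ^ 2 + 4 * L * r) * (h (s - r) * h (s + r)) := by
  have main : ∀ ε > 0, (h s + ε) ^ 2 ≤
      Real.exp (2 * L ^ 2 * r ^ 2 + 4 * L * r) * ((h (s - r) + ε) * (h (s + r) + ε)) := by
    intro ε hε
    have hpos : ∀ σ, 0 < h σ + ε := fun σ => by linarith [h0 σ]
    set N : ℝ → ℝ := fun σ => Q σ / (h σ + ε) with hN
    have hNd : ∀ σ, HasDerivAt N (((2 * Y σ - G σ / 2) * (h σ + ε)
        - Q σ * (2 * Q σ + 2 * p σ)) / (h σ + ε) ^ 2) σ := fun σ =>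
      (hQ σ).div ((hh σ).add_const ε) (hpos σ).ne'
    have hmono : Monotone fun σ => N σ + L ^ 2 / 2 * σ := by
      refine monotone_of_hasDerivAt_nonneg
        (fun σ => (hNd σ).add ((hasDerivAt_id σ).const_mul (L ^ 2 / 2))) fun σ => ?_
      have e := hpos σ
      have : -(L ^ 2 / 2) ≤ ((2 * Y σ - G σ / 2) * (h σ + ε)
        - Q σ * (2 * Q σ + 2 * p σ)) / (h σ + ε) ^ 2 := by
        rw [le_div_iff₀ (by positivity)]
        have h1 := hCS σ
        have h2 := mul_le_mul_of_nonneg_right (hG σ) e.le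
        have h3 := mul_nonneg (mul_nonneg (sq_nonneg L) hε.le) e.le
        nlinarith [sq_nonneg (p σ), mul_nonneg hε.le (hY σ)]
      simp only [Pi.zero_apply, mul_one]
      linarith
    set k : ℝ → ℝ := fun σ => Real.log (h σ + ε) with hk
    have hkd : ∀ σ, HasDerivAt k ((2 * Q σ + 2 * p σ) / (h σ + ε)) σ := fun σ =>
      ((hh σ).add_const ε).log (hpos σ).ne'
    have hkN : ∀ σ, |(2 * Q σ + 2 * p σ) / (h σ + ε) - 2 * N σ| ≤ 2 * L := by
      intro σ
      have e := hpos σ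
      have : (2 * Q σ + 2 * p σ) / (h σ + ε) - 2 * N σ = 2 * p σ / (h σ + ε) := by
        simp only [hN]; ring
      rw [this, abs_div, abs_of_pos e, div_le_iff₀ e, abs_mul, abs_two]
      nlinarith [hp σ, mul_nonneg hL hε.le]
    have up : k s - k (s - r) ≤ (2 * N s + L ^ 2 * r + 2 * L) * r := by
      have := (convex_Icc (s - r) s).image_sub_le_mul_sub_of_deriv_le (f := k)
        (fun σ _ => (hkd σ).continuousAt.continuousWithinAt)
        (fun σ _ => (hkd σ).differentiableAt.differentiableWithinAt)
        (C := 2 * N s + L ^ 2 * r + 2 * L) (fun σ hσ => ?_) (s - r)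
        (left_mem_Icc.2 (by linarith)) s (right_mem_Icc.2 (by linarith)) (by linarith)
      · simpa using this
      · rw [interior_Icc] at hσ
        rw [(hkd σ).deriv]
        have h1 := (abs_le.1 (hkN σ)).2
        have h2 := hmono hσ.2.le
        have h3 : L ^ 2 * (s - σ) ≤ L ^ 2 * r :=
          mul_le_mul_of_nonneg_left (by linarith [hσ.1]) (sq_nonneg L)
        simp only at h2
        linarith
    have lo : (2 * N s - L ^ 2 * r - 2 * L) * r ≤ k (s + r) - k s := by
      have := (convex_Icc s (s + r)).mul_sub_le_image_sub_of_le_deriv (f := k)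
        (fun σ _ => (hkd σ).continuousAt.continuousWithinAt)
        (fun σ _ => (hkd σ).differentiableAt.differentiableWithinAt)
        (C := 2 * N s - L ^ 2 * r - 2 * L) (fun σ hσ => ?_) s
        (left_mem_Icc.2 (by linarith)) (s + r) (right_mem_Icc.2 (by linarith)) (by linarith)
      · simpa using this
      · rw [interior_Icc] at hσ
        rw [(hkd σ).deriv]
        have h1 := (abs_le.1 (hkN σ)).1
        have h2 := hmono hσ.1.le
        have h3 : L ^ 2 * (σ - s) ≤ L ^ 2 * r :=
          mul_le_mul_of_nonneg_left (by linarith [hσ.2]) (sq_nonneg L)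
        simp only at h2
        linarith
    have e1 : 2 * k s ≤ (2 * L ^ 2 * r ^ 2 + 4 * L * r) + (k (s - r) + k (s + r)) := by
      nlinarith
    have e2 := Real.exp_le_exp.2 e1
    rw [Real.exp_add, Real.exp_add (k (s - r)), two_mul, Real.exp_add] at e2
    simp only [hk, Real.exp_log (hpos _)] at e2
    rw [sq]
    exact e2
  have lim : ∀ a : ℝ, Tendsto (fun ε : ℝ => a + ε) (𝓝[>] 0) (𝓝 a) := fun a => by
    have : Tendsto (fun ε : ℝ => a + ε) (𝓝 0) (𝓝 (a + 0)) := by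
      exact (continuous_const.add continuous_id).tendsto 0
    rw [add_zero] at this
    exact this.mono_left nhdsWithin_le_nhds
  exact le_of_tendsto_of_tendsto ((lim (h s)).pow 2)
    (((lim (h (s - r))).mul (lim (h (s + r)))).const_mul _)
    (eventually_nhdsWithin_of_forall main)

theorem norm_J (x : Plane) : ‖J x‖ = ‖x‖ := by
  simp [J, EuclideanSpace.norm_eq, Matrix.toLpLin_apply, dotProduct,
    Fin.sum_univ_two, add_comm]

theorem J_J (x : Plane) : J (J x) = -x := by
  ext i
  fin_cases i <;> simp [J, Matrix.toLpLin_apply, dotProduct, Fin.sum_univ_two]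

theorem inner_J_left (x y : Plane) : inner ℝ (J x) y = -inner ℝ x (J y) := by
  simp [J, Matrix.toLpLin_apply, dotProduct, Fin.sum_univ_two,
    PiLp.inner_apply]

@[fun_prop]
theorem continuous_J : Continuous J := J.continuous_of_finiteDimensional

theorem _root_.HasDerivAt.planeJ {f : ℝ → Plane} {f' : Plane} {x : ℝ} (h : HasDerivAt f f' x) :
    HasDerivAt (fun y => J (f y)) (J f') x :=
  (LinearMap.toContinuousLinearMap J).hasFDerivAt.comp_hasDerivAt x h


/-- The partial derivative in the first variable. -/
def dS (w : ℝ × ℝ → Plane) (z : ℝ × ℝ) : Plane := fderiv ℝ w z (1, 0)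

/-- The partial derivative in the second variable. -/
def dT (w : ℝ × ℝ → Plane) (z : ℝ × ℝ) : Plane := fderiv ℝ w z (0, 1)

/-- The Cauchy–Riemann operator `w ↦ w_s - J w_t`. -/
def dbar (w : ℝ × ℝ → Plane) (z : ℝ × ℝ) : Plane := dS w z - J (dT w z)

section Calculus

variable {w : ℝ × ℝ → Plane} (hw : ContDiff ℝ 1 w)

include hw

theorem continuous_dS : Continuous (dS w) :=
  (hw.continuous_fderiv one_ne_zero).clm_apply continuous_const

theorem continuous_dT : Continuous (dT w) :=
  (hw.continuous_fderiv one_ne_zero).clm_apply continuous_const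

theorem continuous_dbar : Continuous (dbar w) :=
  (continuous_dS hw).sub (continuous_J.comp (continuous_dT hw))

theorem hasDerivAt_comp_curve {γ₁ γ₂ : ℝ → ℝ} {a b r : ℝ} (h₁ : HasDerivAt γ₁ a r)
    (h₂ : HasDerivAt γ₂ b r) :
    HasDerivAt (fun ρ => w (γ₁ ρ, γ₂ ρ)) (a • dS w (γ₁ r, γ₂ r) + b • dT w (γ₁ r, γ₂ r)) r := by
  have h := ((hw.differentiable one_ne_zero) (γ₁ r, γ₂ r)).hasFDerivAt.comp_hasDerivAt r
    (h₁.prodMk h₂)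
  have e : ((a, b) : ℝ × ℝ) = a • ((1, 0) : ℝ × ℝ) + b • ((0, 1) : ℝ × ℝ) := by simp
  rw [e, map_add, map_smul, map_smul] at h
  exact h

theorem hasDerivAt_dS (s t : ℝ) : HasDerivAt (fun σ => w (σ, t)) (dS w (s, t)) s := by
  simpa using hasDerivAt_comp_curve hw (hasDerivAt_id s) (hasDerivAt_const s t)

theorem hasDerivAt_dT (s t : ℝ) : HasDerivAt (fun τ => w (s, τ)) (dT w (s, t)) t := by
  simpa using hasDerivAt_comp_curve hw (hasDerivAt_const t s) (hasDerivAt_id t)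

end Calculus

/-- `∫ ⟨a, J b'⟩` is symmetric on `1`-periodic functions. -/
theorem integral_inner_J_symm {a b a' b' : ℝ → Plane} (ha : ∀ t, HasDerivAt a (a' t) t)
    (hb : ∀ t, HasDerivAt b (b' t) t) (ha' : Continuous a') (hb' : Continuous b')
    (pa : a 1 = a 0) (pb : b 1 = b 0) :
    ∫ t in (0 : ℝ)..1, inner ℝ (a t) (J (b' t)) = ∫ t in (0 : ℝ)..1, inner ℝ (b t) (J (a' t)) := by
  have ca : Continuous a := continuous_iff_continuousAt.2 fun t => (ha t).continuousAt
  have cb : Continuous b := continuous_iff_continuousAt.2 fun t => (hb t).continuousAt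
  have hd : ∀ t, HasDerivAt (fun t => inner ℝ (a t) (J (b t)))
      (inner ℝ (a t) (J (b' t)) - inner ℝ (b t) (J (a' t))) t := by
    intro t
    refine ((ha t).inner ℝ (hb t).planeJ).congr_deriv ?_
    rw [sub_eq_add_neg, real_inner_comm (J (a' t)), inner_J_left, neg_neg]
  have := intervalIntegral.integral_eq_sub_of_hasDerivAt (a := 0) (b := 1) (fun t _ => hd t)
    (Continuous.intervalIntegrable (by fun_prop) _ _)
  rw [pa, pb, sub_self, intervalIntegral.integral_sub
    (Continuous.intervalIntegrable (by fun_prop) _ _)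
    (Continuous.intervalIntegrable (by fun_prop) _ _)] at this
  exact sub_eq_zero.1 this

/-- The Dirichlet form `∫ ⟨w, J w_t⟩` is differentiable in `s` although `w` is only `C¹`. -/
theorem hasDerivAt_integral_inner_J {w : ℝ × ℝ → Plane} (hw : ContDiff ℝ 1 w)
    (per : ∀ s t, w (s, t + 1) = w (s, t)) (s : ℝ) :
    HasDerivAt (fun σ => ∫ t in (0 : ℝ)..1, inner ℝ (w (σ, t)) (J (dT w (σ, t))))
      (∫ t in (0 : ℝ)..1, 2 * inner ℝ (dS w (s, t)) (J (dT w (s, t)))) s := by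
  have cw := hw.continuous
  have cS := continuous_dS hw
  have cT := continuous_dT hw
  have hper : ∀ σ, w (σ, 1) = w (σ, 0) := fun σ => by simpa using per σ 0
  have hslope : ∀ σ, slope (fun σ => ∫ t in (0 : ℝ)..1, inner ℝ (w (σ, t)) (J (dT w (σ, t)))) s σ
      = ∫ t in (0 : ℝ)..1, inner ℝ (slope (fun σ => w (σ, t)) s σ)
          (J (dT w (σ, t)) + J (dT w (s, t))) := by
    intro σ
    have hs := integral_inner_J_symm (hasDerivAt_dT hw s) (hasDerivAt_dT hw σ)
      (by fun_prop) (by fun_prop) (hper s) (hper σ)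
    simp only [slope_def_module, inner_smul_left, inner_sub_left, inner_add_right, conj_trivial, ← mul_add]
    rw [intervalIntegral.integral_const_mul, intervalIntegral.integral_add
      (Continuous.intervalIntegrable (by fun_prop) _ _)
      (Continuous.intervalIntegrable (by fun_prop) _ _), intervalIntegral.integral_sub
      (Continuous.intervalIntegrable (by fun_prop) _ _)
      (Continuous.intervalIntegrable (by fun_prop) _ _), intervalIntegral.integral_sub
      (Continuous.intervalIntegrable (by fun_prop) _ _)
      (Continuous.intervalIntegrable (by fun_prop) _ _), hs, smul_eq_mul]
    ring
  rw [hasDerivAt_iff_tendsto_slope]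
  refine Tendsto.congr (fun σ => (hslope σ).symm) ?_
  have hcpt : IsCompact (Icc (s - 1) (s + 1) ×ˢ Icc (0 : ℝ) 1) := isCompact_Icc.prod isCompact_Icc
  obtain ⟨K₁, hK₁⟩ := hcpt.exists_bound_of_continuousOn cS.continuousOn
  obtain ⟨K₂, hK₂⟩ := hcpt.exists_bound_of_continuousOn cT.continuousOn
  have hs : s ∈ Icc (s - 1) (s + 1) := ⟨by linarith, by linarith⟩
  refine intervalIntegral.tendsto_integral_filter_of_dominated_convergence
    (fun _ => K₁ * (K₂ + K₂)) ?_ ?_ intervalIntegrable_const ?_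
  · refine Eventually.of_forall fun σ => Continuous.aestronglyMeasurable ?_
    simp only [slope_def_module]
    fun_prop
  · have hnb : Icc (s - 1) (s + 1) ∈ 𝓝[≠] s :=
      mem_nhdsWithin_of_mem_nhds (Icc_mem_nhds (by linarith) (by linarith))
    filter_upwards [hnb, self_mem_nhdsWithin] with σ hσ hne
    refine Eventually.of_forall fun t ht => ?_
    rw [uIoc_of_le zero_le_one] at ht
    have ht' : t ∈ Icc (0 : ℝ) 1 := Ioc_subset_Icc_self ht
    have h1 : ‖slope (fun σ => w (σ, t)) s σ‖ ≤ K₁ := by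
      have := (convex_Icc (s - 1) (s + 1)).norm_image_sub_le_of_norm_hasDerivWithin_le
        (fun x _ => (hasDerivAt_dS hw x t).hasDerivWithinAt) (fun x hx => hK₁ (x, t) ⟨hx, ht'⟩) hs hσ
      have hpos : 0 < ‖σ - s‖ := norm_pos_iff.2 (sub_ne_zero.2 hne)
      rw [slope_def_module, norm_smul, norm_inv, inv_mul_le_iff₀ hpos, mul_comm]
      exact this
    have h2 : ‖J (dT w (σ, t)) + J (dT w (s, t))‖ ≤ K₂ + K₂ := by
      refine (norm_add_le _ _).trans (add_le_add ?_ ?_) <;> rw [norm_J]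
      exacts [hK₂ (σ, t) ⟨hσ, ht'⟩, hK₂ (s, t) ⟨hs, ht'⟩]
    exact (norm_inner_le_norm _ _).trans
      (mul_le_mul h1 h2 (norm_nonneg _) ((norm_nonneg _).trans h1))
  · refine Eventually.of_forall fun t _ => ?_
    have h1 := hasDerivAt_iff_tendsto_slope.1 (hasDerivAt_dS hw s t)
    have h2 : Tendsto (fun σ => J (dT w (σ, t)) + J (dT w (s, t))) (𝓝[≠] s)
        (𝓝 (J (dT w (s, t)) + J (dT w (s, t)))) :=
      ((Continuous.tendsto (by fun_prop) s).mono_left nhdsWithin_le_nhds)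
    have := h1.inner h2 (𝕜 := ℝ)
    rwa [inner_add_right, ← two_mul] at this

/-- The square of the `L²` norm on the circle at height `s`. -/
def energy (w : ℝ × ℝ → Plane) (s : ℝ) : ℝ := ∫ t in (0 : ℝ)..1, ‖w (s, t)‖ ^ 2

theorem energy_nonneg (w : ℝ × ℝ → Plane) (s : ℝ) : 0 ≤ energy w s :=
  intervalIntegral.integral_nonneg zero_le_one fun _ _ => by positivity

/-- Almost convexity of the logarithm of the energy for solutions of a differential inequality. -/
theorem energy_sq_le {w : ℝ × ℝ → Plane} (hw : ContDiff ℝ 1 w)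
    (per : ∀ s t, w (s, t + 1) = w (s, t)) {L : ℝ} (hL : 0 ≤ L)
    (hg : ∀ z, ‖dbar w z‖ ≤ L * ‖w z‖) (s : ℝ) {r : ℝ} (hr : 0 ≤ r) :
    energy w s ^ 2 ≤ Real.exp (2 * L ^ 2 * r ^ 2 + 4 * L * r)
      * (energy w (s - r) * energy w (s + r)) := by
  have cw := hw.continuous
  have cS := continuous_dS hw
  have cT := continuous_dT hw
  have cg := continuous_dbar hw
  have eS : ∀ z, dS w z = J (dT w z) + dbar w z := fun z => by simp [dbar]
  refine sq_le_exp_mul_of_frequency (h := energy w)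
    (Q := fun s => ∫ t in (0 : ℝ)..1, inner ℝ (w (s, t)) (J (dT w (s, t))))
    (p := fun s => ∫ t in (0 : ℝ)..1, inner ℝ (w (s, t)) (dbar w (s, t)))
    (Y := fun s => ∫ t in (0 : ℝ)..1, ‖J (dT w (s, t)) + (1 / 2 : ℝ) • dbar w (s, t)‖ ^ 2)
    (G := fun s => ∫ t in (0 : ℝ)..1, ‖dbar w (s, t)‖ ^ 2)
    hL (energy_nonneg w) ?_ ?_ ?_ ?_ ?_ ?_ s hr
  · intro s
    have := hasDerivAt_intervalIntegral_of_continuous (f := fun s t => ‖w (s, t)‖ ^ 2)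
      (f' := fun s t => 2 * inner ℝ (w (s, t)) (dS w (s, t))) (by fun_prop) (by fun_prop)
      (fun s t => (hasDerivAt_dS hw s t).norm_sq) 0 1 s
    refine this.congr_deriv ?_
    simp only [eS, inner_add_right]
    rw [intervalIntegral.integral_const_mul, intervalIntegral.integral_add
      (Continuous.intervalIntegrable (by fun_prop) _ _)
      (Continuous.intervalIntegrable (by fun_prop) _ _)]
    ring
  · intro s
    refine (hasDerivAt_integral_inner_J hw per s).congr_deriv (Eq.symm ?_)
    rw [← intervalIntegral.integral_const_mul, ← intervalIntegral.integral_div,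
      ← intervalIntegral.integral_sub
      (Continuous.intervalIntegrable (by fun_prop) _ _)
      (Continuous.intervalIntegrable (by fun_prop) _ _)]
    congr 1
    ext t
    rw [eS, norm_add_sq_real, inner_add_left, real_inner_self_eq_norm_sq, norm_smul,
      inner_smul_right, real_inner_comm (dbar w (s, t)), Real.norm_eq_abs, mul_pow, sq_abs]
    ring
  · exact fun s => intervalIntegral.integral_nonneg zero_le_one fun _ _ => by positivity
  · intro s
    rw [energy, ← intervalIntegral.integral_const_mul, ← Real.norm_eq_abs]
    refine intervalIntegral.norm_integral_le_of_norm_le zero_le_one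
      (Eventually.of_forall fun t _ => ?_) (Continuous.intervalIntegrable (by fun_prop) _ _)
    refine (norm_inner_le_norm _ _).trans ?_
    nlinarith [hg (s, t), norm_nonneg (w (s, t))]
  · intro s
    rw [energy, ← intervalIntegral.integral_const_mul]
    refine intervalIntegral.integral_mono_on zero_le_one
      (Continuous.intervalIntegrable (by fun_prop) _ _)
      (Continuous.intervalIntegrable (by fun_prop) _ _) fun t _ => ?_
    rw [← mul_pow]
    exact pow_le_pow_left₀ (norm_nonneg _) (hg _) 2
  · intro s
    have := sq_integral_inner_le (x := fun t => w (s, t))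
      (y := fun t => J (dT w (s, t)) + (1 / 2 : ℝ) • dbar w (s, t)) (by fun_prop) (by fun_prop)
    simp only [inner_add_right, inner_smul_right] at this
    rw [intervalIntegral.integral_add
      (Continuous.intervalIntegrable (by fun_prop) _ _)
      (Continuous.intervalIntegrable (by fun_prop) _ _), intervalIntegral.integral_const_mul,
      one_div_mul_eq_div] at this
    exact this


/-- The tangential derivative of `w` has zero integral over every circle, also in the limit of
radius zero. -/
theorem integral_tangential_eq_zero {w : ℝ × ℝ → Plane} (hw : ContDiff ℝ 1 w) (s₀ t₀ r : ℝ) :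
    ∫ θ in (-Real.pi)..Real.pi,
      ((-Real.sin θ) • dS w (s₀ + r * Real.cos θ, t₀ + r * Real.sin θ)
        + Real.cos θ • dT w (s₀ + r * Real.cos θ, t₀ + r * Real.sin θ)) = 0 := by
  have cS := continuous_dS hw
  have cT := continuous_dT hw
  rcases eq_or_ne r 0 with rfl | hr
  · simp only [zero_mul, add_zero]
    rw [intervalIntegral.integral_add (Continuous.intervalIntegrable (by fun_prop) _ _)
      (Continuous.intervalIntegrable (by fun_prop) _ _), intervalIntegral.integral_smul_const,
      intervalIntegral.integral_smul_const]
    simp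
  · have hd : ∀ θ : ℝ, HasDerivAt (fun θ => w (s₀ + r * Real.cos θ, t₀ + r * Real.sin θ))
        (r • ((-Real.sin θ) • dS w (s₀ + r * Real.cos θ, t₀ + r * Real.sin θ)
        + Real.cos θ • dT w (s₀ + r * Real.cos θ, t₀ + r * Real.sin θ))) θ := by
      intro θ
      have := hasDerivAt_comp_curve hw (((Real.hasDerivAt_cos θ).const_mul r).const_add s₀)
        (((Real.hasDerivAt_sin θ).const_mul r).const_add t₀)
      simpa only [smul_add, smul_smul] using this
    have := intervalIntegral.integral_eq_sub_of_hasDerivAt (a := -Real.pi) (b := Real.pi)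
      (fun θ _ => hd θ) (Continuous.intervalIntegrable (by fun_prop) _ _)
    rw [intervalIntegral.integral_smul] at this
    simpa [hr] using this

/-- The approximate mean value property over circles when `dbar w` is bounded. -/
theorem norm_integral_circle_sub_le {w : ℝ × ℝ → Plane} (hw : ContDiff ℝ 1 w) {K : ℝ}
    (hK : ∀ z, ‖dbar w z‖ ≤ K) (s₀ t₀ : ℝ) {r : ℝ} (hr : 0 ≤ r) :
    ‖(∫ θ in (-Real.pi)..Real.pi, w (s₀ + r * Real.cos θ, t₀ + r * Real.sin θ))
      - (2 * Real.pi) • w (s₀, t₀)‖ ≤ 4 * Real.pi * K * r := by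
  have cw := hw.continuous
  have cS := continuous_dS hw
  have cT := continuous_dT hw
  have cg := continuous_dbar hw
  have hd := hasDerivAt_intervalIntegral_of_continuous
    (f := fun r θ => w (s₀ + r * Real.cos θ, t₀ + r * Real.sin θ))
    (f' := fun r θ => Real.cos θ • dS w (s₀ + r * Real.cos θ, t₀ + r * Real.sin θ)
        + Real.sin θ • dT w (s₀ + r * Real.cos θ, t₀ + r * Real.sin θ)) (by fun_prop) (by fun_prop)
    (fun r θ => by
      simpa using hasDerivAt_comp_curve hw (((hasDerivAt_id r).mul_const (Real.cos θ)).const_add s₀)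
        (((hasDerivAt_id r).mul_const (Real.sin θ)).const_add t₀)) (-Real.pi) Real.pi
  have hb : ∀ r : ℝ, ‖∫ θ in (-Real.pi)..Real.pi,
      (Real.cos θ • dS w (s₀ + r * Real.cos θ, t₀ + r * Real.sin θ)
        + Real.sin θ • dT w (s₀ + r * Real.cos θ, t₀ + r * Real.sin θ))‖ ≤ 4 * Real.pi * K := by
    intro r
    have e : ∀ θ z, Real.cos θ • dS w z + Real.sin θ • dT w z
        = J ((-Real.sin θ) • dS w z + Real.cos θ • dT w z)
          + (Real.cos θ • dbar w z + Real.sin θ • J (dbar w z)) := by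
      intro θ z
      simp only [dbar, map_add, map_smul, map_sub, J_J]
      module
    simp_rw [e]
    have hJ := (LinearMap.toContinuousLinearMap J).intervalIntegral_comp_comm
      (μ := volume) (a := -Real.pi) (b := Real.pi)
      (f := fun θ => (-Real.sin θ) • dS w (s₀ + r * Real.cos θ, t₀ + r * Real.sin θ)
        + Real.cos θ • dT w (s₀ + r * Real.cos θ, t₀ + r * Real.sin θ))
      (Continuous.intervalIntegrable (by fun_prop) _ _)
    rw [integral_tangential_eq_zero hw, map_zero] at hJ
    simp only [LinearMap.coe_toContinuousLinearMap'] at hJ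
    rw [intervalIntegral.integral_add (Continuous.intervalIntegrable (by fun_prop) _ _)
      (Continuous.intervalIntegrable (by fun_prop) _ _), hJ, zero_add]
    have := intervalIntegral.norm_integral_le_of_norm_le_const (a := -Real.pi) (b := Real.pi)
      (C := 2 * K) (f := fun θ : ℝ =>
        Real.cos θ • dbar w (s₀ + r * Real.cos θ, t₀ + r * Real.sin θ)
        + Real.sin θ • J (dbar w (s₀ + r * Real.cos θ, t₀ + r * Real.sin θ))) fun θ _ => by
      refine (norm_add_le _ _).trans ?_
      rw [norm_smul, norm_smul, norm_J, Real.norm_eq_abs, Real.norm_eq_abs]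
      have := hK (s₀ + r * Real.cos θ, t₀ + r * Real.sin θ)
      nlinarith [Real.abs_cos_le_one θ, Real.abs_sin_le_one θ,
        norm_nonneg (dbar w (s₀ + r * Real.cos θ, t₀ + r * Real.sin θ))]
    refine this.trans (le_of_eq ?_)
    rw [sub_neg_eq_add, abs_of_pos (by positivity)]
    ring
  have := (convex_univ (𝕜 := ℝ)).norm_image_sub_le_of_norm_hasDerivWithin_le
    (fun x _ => (hd x).hasDerivWithinAt) (fun x _ => hb x) (mem_univ 0) (mem_univ r)
  rw [sub_zero, Real.norm_eq_abs, abs_of_nonneg hr] at this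
  simp only [zero_mul, add_zero, intervalIntegral.integral_const] at this
  rwa [show Real.pi - -Real.pi = 2 * Real.pi by ring] at this

/-- Integration in polar coordinates over a disc. -/
theorem integral_polar_disc {f : ℝ × ℝ → ℝ} (hf : Continuous f) {η : ℝ} (hη : 0 ≤ η) :
    ∫ r in (0 : ℝ)..η, ∫ θ in (-Real.pi)..Real.pi, r * f (r * Real.cos θ, r * Real.sin θ)
      = ∫ p in {p : ℝ × ℝ | p.1 ^ 2 + p.2 ^ 2 < η ^ 2}, f p := by
  have hm : MeasurableSet {p : ℝ × ℝ | p.1 ^ 2 + p.2 ^ 2 < η ^ 2} :=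
    measurableSet_lt (by fun_prop) (by fun_prop)
  have hle : -Real.pi ≤ Real.pi := by linarith [Real.pi_pos]
  rw [← integral_indicator hm, ← integral_comp_polarCoord_symm]
  have e : ∀ p ∈ polarCoord.target,
      p.1 • ({p : ℝ × ℝ | p.1 ^ 2 + p.2 ^ 2 < η ^ 2}.indicator f (polarCoord.symm p))
      = (Ioo 0 η ×ˢ Ioo (-Real.pi) Real.pi).indicator
        (fun p : ℝ × ℝ => p.1 * f (p.1 * Real.cos p.2, p.1 * Real.sin p.2)) p := by
    rintro ⟨r, θ⟩ hp
    simp only [polarCoord_target, mem_prod, mem_Ioi] at hp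
    have h1 : (r * Real.cos θ) ^ 2 + (r * Real.sin θ) ^ 2 = r ^ 2 := by
      linear_combination r ^ 2 * Real.sin_sq_add_cos_sq θ
    by_cases hr : r < η
    · rw [indicator_of_mem, indicator_of_mem]
      · simp
      · exact ⟨⟨hp.1, hr⟩, hp.2⟩
      · simp only [polarCoord_symm_apply, mem_ofPred_eq, h1]
        exact pow_lt_pow_left₀ hr hp.1.le two_ne_zero
    · rw [indicator_of_notMem, indicator_of_notMem, smul_zero]
      · exact fun h => hr h.1.2
      · simp only [polarCoord_symm_apply, mem_ofPred_eq, h1, not_lt]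
        exact pow_le_pow_left₀ hη (not_lt.1 hr) 2
  rw [setIntegral_congr_fun polarCoord.open_target.measurableSet e,
    setIntegral_indicator (measurableSet_Ioo.prod measurableSet_Ioo)]
  have hsub : polarCoord.target ∩ (Ioo 0 η ×ˢ Ioo (-Real.pi) Real.pi)
      = Ioo 0 η ×ˢ Ioo (-Real.pi) Real.pi := by
    rw [inter_eq_right, polarCoord_target]
    exact prod_mono Ioo_subset_Ioi_self subset_rfl
  rw [hsub, Measure.volume_eq_prod, setIntegral_prod, intervalIntegral.integral_of_le hη,
    integral_Ioc_eq_integral_Ioo]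
  · simp only [intervalIntegral.integral_of_le hle, integral_Ioc_eq_integral_Ioo]
  · refine (Continuous.continuousOn (by fun_prop)).integrableOn_compact
      (isCompact_Icc.prod isCompact_Icc) |>.mono_set
      (prod_mono (Ioo_subset_Icc_self (a := 0) (b := η))
        (Ioo_subset_Icc_self (a := -Real.pi) (b := Real.pi)))

theorem integral_norm_le_of_energy_le {w : ℝ × ℝ → Plane} (hw : Continuous w) {α s : ℝ}
    (hα : 0 ≤ α) (h : energy w s ≤ α ^ 2) : ∫ t in (0 : ℝ)..1, ‖w (s, t)‖ ≤ α := by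
  have := sq_integral_inner_le (x := fun t => ‖w (s, t)‖) (y := fun _ => (1 : ℝ)) (by fun_prop)
    continuous_const
  simp only [RCLike.inner_apply, conj_trivial, one_mul, norm_norm, norm_one, one_pow,
    intervalIntegral.integral_const, sub_zero, smul_eq_mul, mul_one] at this
  exact abs_le_of_sq_le_sq' (this.trans h) hα |>.2

/-- A pointwise bound in terms of the energies of nearby circles. -/
theorem norm_le_of_energy_le {w : ℝ × ℝ → Plane} (hw : ContDiff ℝ 1 w)
    (per : ∀ s t, w (s, t + 1) = w (s, t)) {K α η : ℝ} (hK : ∀ z, ‖dbar w z‖ ≤ K) (hα : 0 ≤ α)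
    (hη : 0 < η) (hη' : η ≤ 1 / 2) (s₀ t₀ : ℝ) (hE : ∀ s, |s - s₀| ≤ η → energy w s ≤ α ^ 2) :
    ‖w (s₀, t₀)‖ ≤ 2 * K * η + α / η := by
  have cw := hw.continuous
  have hpi := Real.pi_pos
  have hK0 : 0 ≤ K := (norm_nonneg _).trans (hK 0)
  have hle : -Real.pi ≤ Real.pi := by linarith
  have hcirc : ∀ r, 0 ≤ r → 2 * Real.pi * ‖w (s₀, t₀)‖ * r ≤ 4 * Real.pi * K * r ^ 2
      + ∫ θ in (-Real.pi)..Real.pi, r * ‖w (s₀ + r * Real.cos θ, t₀ + r * Real.sin θ)‖ := by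
    intro r hr
    have h1 := norm_integral_circle_sub_le hw hK s₀ t₀ hr
    have h2 := intervalIntegral.norm_integral_le_integral_norm (μ := volume)
      (f := fun θ => w (s₀ + r * Real.cos θ, t₀ + r * Real.sin θ)) hle
    have h3 := norm_sub_norm_le ((2 * Real.pi) • w (s₀, t₀))
      (∫ θ in (-Real.pi)..Real.pi, w (s₀ + r * Real.cos θ, t₀ + r * Real.sin θ))
    rw [norm_sub_rev, norm_smul, Real.norm_eq_abs, abs_of_pos (by positivity)] at h3
    rw [intervalIntegral.integral_const_mul]
    nlinarith
  have hint : Real.pi * ‖w (s₀, t₀)‖ * η ^ 2 ≤ 4 * Real.pi * K * (η ^ 3 / 3)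
      + ∫ r in (0 : ℝ)..η, ∫ θ in (-Real.pi)..Real.pi,
        r * ‖w (s₀ + r * Real.cos θ, t₀ + r * Real.sin θ)‖ := by
    have ci : Continuous fun r => ∫ θ in (-Real.pi)..Real.pi,
        r * ‖w (s₀ + r * Real.cos θ, t₀ + r * Real.sin θ)‖ :=
      intervalIntegral.continuous_parametric_intervalIntegral_of_continuous' (by fun_prop) _ _
    have := intervalIntegral.integral_mono_on (μ := volume) hη.le
      (Continuous.intervalIntegrable (by fun_prop) _ _)
      (Continuous.intervalIntegrable (by fun_prop) _ _) fun r hr => hcirc r hr.1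
    rw [intervalIntegral.integral_add (Continuous.intervalIntegrable (by fun_prop) _ _)
      (Continuous.intervalIntegrable (by fun_prop) _ _), intervalIntegral.integral_const_mul,
      intervalIntegral.integral_const_mul, integral_pow, integral_id] at this
    simp only [intervalIntegral.integral_const_mul] at this ⊢
    norm_num at this
    linarith
  have hsq : ∫ p in {p : ℝ × ℝ | p.1 ^ 2 + p.2 ^ 2 < η ^ 2}, ‖w (s₀ + p.1, t₀ + p.2)‖
      ≤ 2 * η * α := by
    have hI : IntegrableOn (fun p : ℝ × ℝ => ‖w (s₀ + p.1, t₀ + p.2)‖)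
        (Icc (-η) η ×ˢ Icc (-(1 / 2)) (1 / 2)) :=
      (Continuous.continuousOn (by fun_prop)).integrableOn_compact
        (isCompact_Icc.prod isCompact_Icc)
    have hsub : {p : ℝ × ℝ | p.1 ^ 2 + p.2 ^ 2 < η ^ 2} ⊆ Icc (-η) η ×ˢ Icc (-(1 / 2)) (1 / 2) := by
      intro p hp
      simp only [mem_ofPred_eq] at hp
      have h1 := abs_le_of_sq_le_sq' (show p.1 ^ 2 ≤ η ^ 2 by nlinarith) hη.le
      have h2 := abs_le_of_sq_le_sq' (show p.2 ^ 2 ≤ η ^ 2 by nlinarith) hη.le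
      exact ⟨h1, by constructor <;> linarith [h2.1, h2.2]⟩
    refine (setIntegral_mono_set hI (Eventually.of_forall fun p => norm_nonneg _)
      hsub.eventuallyLE).trans ?_
    rw [Measure.volume_eq_prod, setIntegral_prod _ (by rwa [← Measure.volume_eq_prod])]
    have hin : ∀ s ∈ Icc (-η) η, ∫ t in Icc (-(1 / 2)) (1 / 2), ‖w (s₀ + s, t₀ + t)‖ ≤ α := by
      intro s hs
      have hp : Function.Periodic (fun t => ‖w (s₀ + s, t)‖) 1 := fun t => by simp only [per]
      have := hp.intervalIntegral_add_eq (t₀ - 1 / 2) 0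
      rw [integral_Icc_eq_integral_Ioc, ← intervalIntegral.integral_of_le (by norm_num),
        intervalIntegral.integral_comp_add_left (fun t => ‖w (s₀ + s, t)‖),
        show t₀ + -(1 / 2) = t₀ - 1 / 2 by ring, show t₀ + 1 / 2 = t₀ - 1 / 2 + 1 by ring, this,
        zero_add]
      exact integral_norm_le_of_energy_le cw hα
        (hE _ (by rw [add_sub_cancel_left]; exact abs_le.2 hs))
    have := norm_setIntegral_le_of_norm_le_const (μ := volume) (s := Icc (-η) η) (C := α)
      (f := fun s => ∫ t in Icc (-(1 / 2)) (1 / 2), ‖w (s₀ + s, t₀ + t)‖) (by simp) fun s hs => by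
        rw [Real.norm_eq_abs, abs_of_nonneg (integral_nonneg fun _ => norm_nonneg _)]
        exact hin s hs
    refine (le_abs_self _).trans (this.trans (le_of_eq ?_))
    rw [Real.volume_real_Icc_of_le (by linarith)]
    ring
  have hpol := integral_polar_disc (f := fun p => ‖w (s₀ + p.1, t₀ + p.2)‖) (by fun_prop) hη.le
  simp only at hpol
  rw [hpol] at hint
  have h4 : ‖w (s₀, t₀)‖ * η ≤ 2 * K * η ^ 2 + α := by
    have h5 : Real.pi * (‖w (s₀, t₀)‖ * η) ≤ Real.pi * (2 * K * η ^ 2 + α) := by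
      have h6 : η * (Real.pi * (‖w (s₀, t₀)‖ * η)) ≤ η * (Real.pi * (2 * K * η ^ 2 + α)) := by
        nlinarith [mul_nonneg (mul_nonneg hpi.le hK0) (pow_pos hη 3).le,
          mul_nonneg (mul_nonneg hη.le hα) (sub_nonneg.2 Real.two_le_pi)]
      exact le_of_mul_le_mul_left h6 hη
    exact le_of_mul_le_mul_left h5 hpi
  have h7 : 2 * K * η + α / η = (2 * K * η ^ 2 + α) / η := by field_simp
  rw [h7, le_div_iff₀ hη]
  exact h4


/-- A smooth field is Lipschitz on balls, uniformly in time. -/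
theorem SmoothField.exists_lipschitz {F : UnitAddCircle → Plane → Plane} (hF : SmoothField F)
    (C : ℝ) : ∃ L, 0 ≤ L ∧ ∀ (t : UnitAddCircle) (x y : Plane), ‖x‖ ≤ C → ‖y‖ ≤ C →
      ‖F t x - F t y‖ ≤ L * ‖x - y‖ := by
  unfold SmoothField at hF
  obtain ⟨L, hL⟩ := ((isCompact_Icc (a := (0 : ℝ)) (b := 1)).prod
    (isCompact_closedBall (0 : Plane) C)).exists_bound_of_continuousOn
    (hF.continuous_fderiv (by simp)).continuousOn
  have hconv : Convex ℝ (Icc (0 : ℝ) 1 ×ˢ Metric.closedBall (0 : Plane) C) :=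
    (convex_Icc 0 1).prod (convex_closedBall 0 C)
  refine ⟨max L 0, le_max_right _ _, fun t x y hx hy => ?_⟩
  obtain ⟨τ, hτ, rfl⟩ : ∃ τ ∈ Icc (0 : ℝ) 1, (τ : UnitAddCircle) = t := by
    have := AddCircle.coe_image_Icc_eq (1 : ℝ) 0
    rw [zero_add] at this
    have ht : t ∈ (univ : Set UnitAddCircle) := mem_univ t
    rwa [← this] at ht
  have := hconv.norm_image_sub_le_of_norm_fderiv_le
    (fun z _ => (hF.differentiable (by simp)) z) hL (x := (τ, y)) (y := (τ, x))
    ⟨hτ, by simpa using hy⟩ ⟨hτ, by simpa using hx⟩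
  rw [Prod.mk_sub_mk, sub_self, Prod.norm_mk, norm_zero,
    max_eq_right (norm_nonneg (x - y))] at this
  exact this.trans (mul_le_mul_of_nonneg_right (le_max_left _ _) (norm_nonneg _))

/-- The lift to the plane of a map on the cylinder. -/
def lift (u : C(Cylinder, Plane)) (z : ℝ × ℝ) : Plane := u (z.1, (z.2 : UnitAddCircle))

theorem IsSolution.dbar_lift {F : UnitAddCircle → Plane → Plane} {u : C(Cylinder, Plane)}
    (hu : IsSolution F u) (z : ℝ × ℝ) :
    dbar (lift u) z = -J (F (z.2 : UnitAddCircle) (lift u z)) := by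
  have h := hu.equation z.1 z.2
  have hc : ContDiff ℝ 1 (lift u) := hu.contDiff
  have h1 : deriv (fun σ : ℝ => u (σ, (z.2 : UnitAddCircle))) z.1 = dS (lift u) z :=
    (hasDerivAt_dS hc z.1 z.2).deriv
  have h2 : deriv (fun τ : ℝ => u (z.1, (τ : UnitAddCircle))) z.2 = dT (lift u) z :=
    (hasDerivAt_dT hc z.1 z.2).deriv
  rw [h1, h2, map_sub] at h
  rw [dbar, lift, ← sub_eq_zero, ← h]
  abel

theorem dbar_sub {u v : ℝ × ℝ → Plane} (hu : ContDiff ℝ 1 u) (hv : ContDiff ℝ 1 v) (z : ℝ × ℝ) :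
    dbar (fun z => u z - v z) z = dbar u z - dbar v z := by
  simp only [dbar, dS, dT]
  rw [fderiv_fun_sub (hu.differentiable one_ne_zero z) (hv.differentiable one_ne_zero z)]
  simp only [sub_apply, map_sub]
  abel

theorem energy_le_sq {w : ℝ × ℝ → Plane} (hw : Continuous w) {M s : ℝ}
    (h : ∀ t, ‖w (s, t)‖ ≤ M) : energy w s ≤ M ^ 2 := by
  have := intervalIntegral.integral_mono_on (μ := volume) (zero_le_one' ℝ)
    (f := fun t => ‖w (s, t)‖ ^ 2) (g := fun _ => M ^ 2)
    (Continuous.intervalIntegrable (by fun_prop) _ _)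
    intervalIntegrable_const fun t _ => pow_le_pow_left₀ (norm_nonneg _) (h t) 2
  simpa [energy] using this

/-- The energy at any height is controlled by the energy at height zero. -/
theorem energy_sq_le_of_bounded {w : ℝ × ℝ → Plane} (hw : ContDiff ℝ 1 w)
    (per : ∀ s t, w (s, t + 1) = w (s, t)) {L M δ R s : ℝ} (hL : 0 ≤ L)
    (hg : ∀ z, ‖dbar w z‖ ≤ L * ‖w z‖) (hM : ∀ z, ‖w z‖ ≤ M) (hδ : ∀ t, ‖w (0, t)‖ ≤ δ)
    (hs : |s| ≤ R) :
    energy w s ^ 2 ≤ Real.exp (2 * L ^ 2 * R ^ 2 + 4 * L * R) * (δ ^ 2 * M ^ 2) := by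
  have h0 := energy_le_sq hw.continuous hδ
  have hB : ∀ σ, energy w σ ≤ M ^ 2 := fun σ => energy_le_sq hw.continuous fun t => hM _
  have hmul : energy w (s - |s|) * energy w (s + |s|) ≤ δ ^ 2 * M ^ 2 := by
    rcases abs_cases s with ⟨e, _⟩ | ⟨e, _⟩
    · rw [e, sub_self]
      exact mul_le_mul h0 (hB _) (energy_nonneg _ _) (sq_nonneg _)
    · rw [e, add_neg_cancel, mul_comm]
      exact mul_le_mul h0 (hB _) (energy_nonneg _ _) (sq_nonneg _)
  refine (energy_sq_le hw per hL hg s (abs_nonneg s)).trans ?_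
  refine mul_le_mul (Real.exp_le_exp.2 ?_) hmul
    (mul_nonneg (energy_nonneg _ _) (energy_nonneg _ _)) (Real.exp_pos _).le
  gcongr

/-- Bounded solutions depend on their values at `s = 0` uniformly on compact sets. -/
theorem exists_delta_norm_sub_le {F : UnitAddCircle → Plane → Plane} (hF : SmoothField F)
    {C : ℝ} (hC : 0 < C) {R ε : ℝ} (hR : 0 ≤ R) (hε : 0 < ε) : ∃ δ > 0, ∀ u ∈ solutionSpace F C,
      ∀ v ∈ solutionSpace F C, (∀ t : UnitAddCircle, ‖u (0, t) - v (0, t)‖ ≤ δ) →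
      ∀ (s : ℝ) (t : UnitAddCircle), |s| ≤ R → ‖u (s, t) - v (s, t)‖ ≤ ε := by
  obtain ⟨L, hL, hLip⟩ := hF.exists_lipschitz C
  set M := 2 * C with hM
  have hM0 : 0 < M := by positivity
  set E := Real.exp (2 * L ^ 2 * (R + 1) ^ 2 + 4 * L * (R + 1)) with hE
  have hE1 : 1 ≤ E := Real.one_le_exp (by positivity)
  set η := min (1 / 2) (ε / (4 * (L * M + 1))) with hη
  have hLM : 0 ≤ L * M := by positivity
  have hη0 : 0 < η := lt_min (by norm_num) (by positivity)
  have hη1 : η ≤ 1 / 2 := min_le_left _ _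
  have hη2 : 2 * (L * M) * η ≤ ε / 2 := by
    have : η * (4 * (L * M + 1)) ≤ ε := (le_div_iff₀ (by positivity)).1 (min_le_right _ _)
    nlinarith
  set α := η * (ε / 2) with hα
  have hα0 : 0 < α := by positivity
  refine ⟨α ^ 2 / (E * M), by positivity, fun u hu v hv h s t hs => ?_⟩
  obtain ⟨t, rfl⟩ := QuotientAddGroup.mk_surjective t
  have cu : ContDiff ℝ 1 (lift u) := hu.1.contDiff
  have cv : ContDiff ℝ 1 (lift v) := hv.1.contDiff
  set w : ℝ × ℝ → Plane := fun z => lift u z - lift v z with hw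
  have cw : ContDiff ℝ 1 w := cu.sub cv
  have per : ∀ s t, w (s, t + 1) = w (s, t) := fun s t => by
    simp only [hw, lift, AddCircle.coe_add_period]
  have hg : ∀ z, ‖dbar w z‖ ≤ L * ‖w z‖ := fun z => by
    rw [dbar_sub cu cv, hu.1.dbar_lift, hv.1.dbar_lift, neg_sub_neg, ← map_sub, norm_J,
      norm_sub_rev]
    exact hLip _ _ _ (hu.2 _) (hv.2 _)
  have hwM : ∀ z, ‖w z‖ ≤ M := fun z => by
    refine (norm_sub_le _ _).trans ?_
    rw [hM, two_mul]
    exact add_le_add (hu.2 _) (hv.2 _)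
  have henergy : ∀ σ, |σ - s| ≤ η → energy w σ ≤ α ^ 2 := by
    intro σ hσ
    have hσR : |σ| ≤ R + 1 := by
      have := abs_add_le (σ - s) s
      rw [sub_add_cancel] at this
      linarith
    have h1 := energy_sq_le_of_bounded cw per hL hg hwM (fun t => h t) hσR
    rw [← hE] at h1
    have h2 : E * ((α ^ 2 / (E * M)) ^ 2 * M ^ 2) = (α ^ 2) ^ 2 / E := by
      have : E ≠ 0 := by positivity
      field_simp
    rw [h2] at h1
    exact (abs_le_of_sq_le_sq' (h1.trans (div_le_self (by positivity) hE1)) (by positivity)).2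
  have := norm_le_of_energy_le cw per (K := L * M)
    (fun z => (hg z).trans (mul_le_mul_of_nonneg_left (hwM z) hL)) hα0.le hη0 hη1 s t henergy
  have e : α / η = ε / 2 := by rw [hα]; field_simp
  rw [e] at this
  exact this.trans (by linarith)

theorem eq_of_forall_zero_eq {F : UnitAddCircle → Plane → Plane} (hF : SmoothField F)
    {C : ℝ} (hC : 0 < C) {u v : C(Cylinder, Plane)} (hu : u ∈ solutionSpace F C)
    (hv : v ∈ solutionSpace F C) (h : ∀ t : UnitAddCircle, u (0, t) = v (0, t)) : u = v := by
  ext1 ⟨s, t⟩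
  rw [← sub_eq_zero, ← norm_le_zero_iff]
  refine le_of_forall_pos_le_add fun ε hε => ?_
  obtain ⟨δ, hδ, H⟩ := exists_delta_norm_sub_le hF hC (abs_nonneg s) hε
  rw [zero_add]
  exact H u hu v hv (fun t => by rw [h t, sub_self, norm_zero]; exact hδ.le) s t le_rfl

theorem continuous_iota : Continuous iota :=
  ContinuousMap.continuous_precomp _

theorem isEmbedding_iota {F : UnitAddCircle → Plane → Plane} (hF : SmoothField F)
    {C : ℝ} (hC : 0 < C) :
    IsEmbedding fun u : solutionSpace F C => iota (u : C(Cylinder, Plane)) := by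
  have hcont : Continuous fun u : solutionSpace F C => iota (u : C(Cylinder, Plane)) :=
    continuous_iota.comp continuous_subtype_val
  refine ⟨isInducing_iff_nhds.2 fun u => le_antisymm (hcont.tendsto u).le_comap ?_, ?_⟩
  · refine tendsto_id'.1 (tendsto_subtype_rng.2 ?_)
    rw [ContinuousMap.tendsto_iff_forall_isCompact_tendstoUniformlyOn]
    intro K hK
    rw [Metric.tendstoUniformlyOn_iff]
    intro ε hε
    obtain ⟨R, hR⟩ := hK.exists_bound_of_continuousOn (f := Prod.fst) continuous_fst.continuousOn
    obtain ⟨δ, hδ, H⟩ := exists_delta_norm_sub_le hF hC (le_max_right R 0) (half_pos hε)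
    filter_upwards [preimage_mem_comap (Metric.closedBall_mem_nhds _ hδ)] with v hv z hz
    rw [dist_eq_norm]
    refine (H u u.2 v v.2 (fun t => ?_) z.1 z.2 ((hR z hz).trans (le_max_left _ _))).trans_lt
      (half_lt_self hε)
    rw [← dist_eq_norm, dist_comm]
    exact (ContinuousMap.dist_apply_le_dist (f := iota v) (g := iota u) t).trans hv
  · intro u v huv
    exact Subtype.ext (eq_of_forall_zero_eq hF hC u.2 v.2 fun t => DFunLike.congr_fun huv t)

end NonlinearCR

end

theorem mainTheorem8
    (F : UnitAddCircle → NonlinearCR.Plane → NonlinearCR.Plane)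
    (hF : NonlinearCR.SmoothField F) :
    (∀ C : ℝ, 0 < C →
      IsHomeomorph (Set.imageFactorization NonlinearCR.iota (NonlinearCR.solutionSpace F C))) ∧
    (∀ u v : C(NonlinearCR.Cylinder, NonlinearCR.Plane),
      NonlinearCR.IsSolution F u → NonlinearCR.IsSolution F v →
      (∃ C : ℝ, ∀ z : NonlinearCR.Cylinder, ‖u z‖ ≤ C) →
      (∃ C : ℝ, ∀ z : NonlinearCR.Cylinder, ‖v z‖ ≤ C) →
      (∀ t : UnitAddCircle, u (0, t) = v (0, t)) → u = v) := by
  refine ⟨fun C hC => ?_, fun u v hu hv ⟨C₁, h₁⟩ ⟨C₂, h₂⟩ h => ?_⟩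
  · rw [isHomeomorph_iff_isEmbedding_surjective]
    refine ⟨Topology.IsEmbedding.of_comp ?_ continuous_subtype_val
      (NonlinearCR.isEmbedding_iota hF hC), Set.imageFactorization_surjective⟩
    exact (NonlinearCR.continuous_iota.comp continuous_subtype_val).subtype_mk _
  · refine NonlinearCR.eq_of_forall_zero_eq hF (C := max (max C₁ C₂) 1) (by positivity)
      ⟨hu, fun z => (h₁ z).trans ?_⟩ ⟨hv, fun z => (h₂ z).trans ?_⟩ h
    · exact (le_max_left _ _).trans (le_max_left _ _)
    · exact (le_max_right _ _).trans (le_max_left _ _)
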